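/- \textbf{Theorem.} A \emph{self-similar arc} in $\mathbb{R}^N$ is a set $\Lambda\subset\mathbb{R}^N$ homeomorphic to $[0,1]$ for which there are maps $S_1,\dots,S_\ell:\mathbb{R}^N\to\mathbb{R}^N$ and ratios $r_1,\dots,r_\ell\in(0,1)$ with $|S_i(x)-S_i(y)|=r_i|x-y|$ for all $x,y\in\mathbb{R}^N$, such that $\Lambda=\bigcup_{i=1}^{\ell}S_i(\Lambda)$, the set $S_i(\Lambda)\cap S_j(\Lambda)$ is a singleton if $|i-j|=1$, and $S_i(\Lambda)\cap S_j(\Lambda)=\emptyset$ if $|i-j|>1$. Let $\Lambda\subset\mathbb{R}^N$ be a self-similar arc of Hausdorff dimension $s>1$. Then $\Lambda$ is a strict Whitney set with criticality $s$, that is: (1) $\Lambda$ is connected and there is a $C^1$ function $f:\mathbb{R}^N\to\mathbb{R}$ such that $\nabla f(x)=0$ for every $x\in\Lambda$, while $f$ is not constant on $\Lambda$ and is constant on no non-empty relatively open subset of $\Lambda$; (2) $\mathrm{Cr}(\Lambda)=s$, where $$\mathrm{Cr}(\Lambda)=\sup\{r\in\mathbb{R}:\ \text{there are a non-constant } f:\Lambda\to\mathbb{R}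 \text{ and } M>0 \text{ with } |f(x)-f(y)|\le M|x-y|^r \text{ for all } x,y\in\Lambda\}.$$ -/

import Mathlib

/-- A map of a metric space into itself that multiplies all distances by one ratio `r ∈ (0, 1)`. -/
def IsContractiveSimilitude {X : Type*} [MetricSpace X] (S : X → X) : Prop :=
  ∃ r : ℝ, 0 < r ∧ r < 1 ∧ ∀ x y : X, dist (S x) (S y) = r * dist x y

/-- `K` is the self-similar set (the non-empty compact invariant set) of the finite family `S`
of contractive similitudes. -/
structure IsSelfSimilarSet {X : Type*} [MetricSpace X] {l : ℕ} (S : Fin l → X → X)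
    (K : Set X) : Prop where
  similitude : ∀ i, IsContractiveSimilitude (S i)
  nonempty : K.Nonempty
  isCompact : IsCompact K
  invariant : K = ⋃ i, S i '' K

/-- An arc: a homeomorphic image of `[0, 1]`. -/
def IsArc {X : Type*} [TopologicalSpace X] (A : Set X) : Prop :=
  Nonempty (unitInterval ≃ₜ A)

/-- A self-similar arc: an arc that is the self-similar set of a finite family
`S 0, …, S (l - 1)` of contractive similitudes for which consecutive pieces `S i '' A` meet in
exactly one point and non-consecutive pieces are disjoint. -/
def IsSelfSimilarArc {X : Type*} [MetricSpace X] (A : Set X) : Prop :=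
  IsArc A ∧ ∃ (l : ℕ) (S : Fin l → X → X), IsSelfSimilarSet S A ∧
    (∀ i j : Fin l, (i : ℕ) + 1 = j → ∃ z, S i '' A ∩ S j '' A = {z}) ∧
    (∀ i j : Fin l, (i : ℕ) + 1 < j → S i '' A ∩ S j '' A = ∅)

/-- A Whitney function for `E`: a `C¹` function on `ℝᴺ` whose gradient vanishes at every point of
`E`, but which is not constant on `E`. -/
structure IsWhitneyFunction {N : ℕ} (f : EuclideanSpace ℝ (Fin N) → ℝ)
    (E : Set (EuclideanSpace ℝ (Fin N))) : Prop where
  contDiff : ContDiff ℝ 1 f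
  gradient_eq_zero : ∀ x ∈ E, gradient f x = 0
  nonconstant : ∃ x ∈ E, ∃ y ∈ E, f x ≠ f y

/-- A strict Whitney function for `E`: a Whitney function that is constant on no non-empty
relatively open subset `U ∩ E` of `E`. -/
structure IsStrictWhitneyFunction {N : ℕ} (f : EuclideanSpace ℝ (Fin N) → ℝ)
    (E : Set (EuclideanSpace ℝ (Fin N))) : Prop extends IsWhitneyFunction f E where
  nonconstant_on_open : ∀ U : Set (EuclideanSpace ℝ (Fin N)), IsOpen U → (U ∩ E).Nonempty →
    ∃ x ∈ U ∩ E, ∃ y ∈ U ∩ E, f x ≠ f y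

/-- A strict Whitney set: a connected set with a strict Whitney function. -/
def IsStrictWhitneySet {N : ℕ} (E : Set (EuclideanSpace ℝ (Fin N))) : Prop :=
  IsConnected E ∧ ∃ f : EuclideanSpace ℝ (Fin N) → ℝ, IsStrictWhitneyFunction f E

/-- The exponents `r` for which `E` carries a non-constant real function `f` with
`|f x - f y| ≤ M |x - y| ^ r` on `E`. -/
def holderExponents {X : Type*} [MetricSpace X] (E : Set X) : Set ℝ :=
  {r | ∃ f : E → ℝ, (∃ x y, f x ≠ f y) ∧
    ∃ M : ℝ, 0 < M ∧ ∀ x y : E, |f x - f y| ≤ M * dist x y ^ r}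

/-- The criticality of `E`: the supremum of these exponents, taken in the extended reals, so that
it is a genuine supremum for every `E`. -/
noncomputable def criticality {X : Type*} [MetricSpace X] (E : Set X) : EReal :=
  sSup ((fun r : ℝ => (r : EReal)) '' holderExponents E)

/-!
Let `r` be smaller than the dimension of `Λ`, so that `∑ ρᵢ ^ r > 1` for the ratios `ρᵢ` of the
pieces. By iteration, strictly between any two given points there are finitely many copies of `Λ`,
meeting pairwise in at most one point, whose ratios `σⱼ` satisfy `∑ σⱼ ^ r ≥ 1`. A chain of points
with small jumps from one of the two points to the other must run through every copy, and its part
in the `j`-th copy is a shorter chain of this kind, scaled by `σⱼ`. By induction on the length, the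
cost `∑ dist (xₖ) (xₖ₊₁) ^ r` of these chains is bounded below by a positive constant. The infimum
of the costs of the chains joining two points is therefore a metric on `Λ`, dominated by `dist ^ r`,
and every Lipschitz function for it is `r`-Hölder on `Λ`. Composing a Kuratowski embedding with a
generic functional gives such a function which is injective on a dense sequence, hence constant on
no open set. For `r > 1` it is the restriction of a `C¹` function with zero derivative on `Λ`, by
Whitney's extension theorem.

Conversely, a non-constant `r`-Hölder function on a connected set has an interval as its range, so
that `1 ≤ dimH Λ / r`.
-/

open Set Function Metric MeasureTheory Filter Topology
open scoped NNReal ENNReal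

section Cylinder

variable {Y ι : Type*}

/-- The composition `φ (w 0) ∘ ⋯ ∘ φ (w (k - 1))` along the word `w`, whose range is the cylinder
of generation `k` coded by `w`. -/
def cylinderMap (φ : ι → Y → Y) : {k : ℕ} → (Fin k → ι) → Y → Y
  | 0, _ => id
  | _ + 1, w => φ (w 0) ∘ cylinderMap φ (Fin.tail w)

theorem exists_cylinderMap_eq {φ : ι → Y → Y} (hcover : ∀ y, ∃ i x, φ i x = y) (k : ℕ) (y : Y) :
    ∃ (w : Fin k → ι) (x : Y), cylinderMap φ w x = y := by
  induction k generalizing y with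
  | zero => exact ⟨Fin.elim0, y, rfl⟩
  | succ k ih =>
    obtain ⟨i, z, rfl⟩ := hcover y
    obtain ⟨w, x, rfl⟩ := ih z
    exact ⟨Fin.cons i w, x, rfl⟩

theorem lipschitzWith_cylinderMap [PseudoEMetricSpace Y] {φ : ι → Y → Y} {ρ : ι → ℝ≥0}
    (hφ : ∀ i, LipschitzWith (ρ i) (φ i)) {k : ℕ} (w : Fin k → ι) :
    LipschitzWith (∏ i, ρ (w i)) (cylinderMap φ w) := by
  induction k with
  | zero =>
    rw [Finset.univ_eq_empty, Finset.prod_empty]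
    exact LipschitzWith.id
  | succ k ih =>
    rw [Fin.prod_univ_succ]
    exact (hφ (w 0)).comp (ih (Fin.tail w))

theorem ediam_range_cylinderMap_le [PseudoEMetricSpace Y] {φ : ι → Y → Y} {ρ : ι → ℝ≥0}
    (hφ : ∀ i, LipschitzWith (ρ i) (φ i)) {k : ℕ} (w : Fin k → ι) :
    ediam (range (cylinderMap φ w)) ≤ (∏ i, ρ (w i) : ℝ≥0) * ediam (univ : Set Y) := by
  simpa only [image_univ] using (lipschitzWith_cylinderMap hφ w).ediam_image_le univ

theorem exists_tendsto_zero_ediam_range_cylinderMap_le [Finite ι] [PseudoMetricSpace Y]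
    [BoundedSpace Y] {φ : ι → Y → Y} {ρ : ι → ℝ≥0} (hφ : ∀ i, LipschitzWith (ρ i) (φ i))
    (hρ : ∀ i, ρ i < 1) :
    ∃ u : ℕ → ℝ≥0∞, Tendsto u atTop (𝓝 0) ∧
      ∀ k (w : Fin k → ι), ediam (range (cylinderMap φ w)) ≤ u k := by
  have := Fintype.ofFinite ι
  have hq : Finset.univ.sup ρ < 1 := (Finset.sup_lt_iff one_pos).2 fun i _ => hρ i
  refine ⟨fun k => (Finset.univ.sup ρ ^ k : ℝ≥0) * ediam (univ : Set Y), ?_, fun k w => ?_⟩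
  · have hpow := ENNReal.tendsto_coe.2 (NNReal.tendsto_pow_atTop_nhds_zero_of_lt_one hq)
    simpa using ENNReal.Tendsto.mul_const hpow
      (Or.inr (Bornology.IsBounded.all (univ : Set Y)).ediam_ne_top)
  · refine (ediam_range_cylinderMap_le hφ w).trans (mul_le_mul_left (ENNReal.coe_le_coe.2 ?_) _)
    simpa using Finset.prod_le_pow_card Finset.univ (fun i => ρ (w i)) (Finset.univ.sup ρ)
      fun i _ => Finset.le_sup (Finset.mem_univ (w i))

theorem exists_range_cylinderMap_subset [Finite ι] [PseudoMetricSpace Y] [BoundedSpace Y]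
    {φ : ι → Y → Y} {ρ : ι → ℝ≥0} (hφ : ∀ i, LipschitzWith (ρ i) (φ i)) (hρ : ∀ i, ρ i < 1)
    (hcover : ∀ y, ∃ i x, φ i x = y) {U : Set Y} (hU : IsOpen U) (hne : U.Nonempty) :
    ∃ (k : ℕ) (w : Fin k → ι), range (cylinderMap φ w) ⊆ U := by
  obtain ⟨y, hy⟩ := hne
  obtain ⟨ε, hε, hball⟩ := Metric.isOpen_iff.1 hU y hy
  obtain ⟨u, hu, hdiam⟩ := exists_tendsto_zero_ediam_range_cylinderMap_le hφ hρ
  obtain ⟨k, hk⟩ := (hu.eventually_lt_const (ENNReal.ofReal_pos.2 hε)).exists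
  obtain ⟨w, x, hx⟩ := exists_cylinderMap_eq hcover k y
  refine ⟨k, w, fun z hz => hball ?_⟩
  rw [Metric.mem_ball, ← ENNReal.ofReal_lt_ofReal_iff hε, ← edist_dist]
  exact (edist_le_ediam_of_mem hz ⟨x, hx⟩).trans_lt ((hdiam k w).trans_lt hk)

theorem dimH_univ_le_of_sum_rpow_le_one [Fintype ι] [MetricSpace Y] [BoundedSpace Y]
    {φ : ι → Y → Y} {ρ : ι → ℝ≥0} (hφ : ∀ i, LipschitzWith (ρ i) (φ i)) (hρ : ∀ i, ρ i < 1)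
    (hcover : ∀ y, ∃ i x, φ i x = y) {r : ℝ≥0} (hsum : ∑ i, ρ i ^ (r : ℝ) ≤ 1) :
    dimH (univ : Set Y) ≤ r := by
  borelize Y
  obtain ⟨u, hu, hdiam⟩ := exists_tendsto_zero_ediam_range_cylinderMap_le hφ hρ
  set D := ediam (univ : Set Y)
  have hbound (k : ℕ) : ∑ w : Fin k → ι, ediam (range (cylinderMap φ w)) ^ (r : ℝ) ≤ D ^ (r : ℝ) :=
    calc ∑ w : Fin k → ι, ediam (range (cylinderMap φ w)) ^ (r : ℝ)
        ≤ ∑ w : Fin k → ι, ((∏ i, ρ (w i) : ℝ≥0) * D) ^ (r : ℝ) := by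
          gcongr with w; exact ediam_range_cylinderMap_le hφ w
      _ = (∑ w : Fin k → ι, ∏ i, ρ (w i) ^ (r : ℝ) : ℝ≥0) * D ^ (r : ℝ) := by
          simp only [ENNReal.mul_rpow_of_nonneg _ _ r.coe_nonneg, ENNReal.ofNNReal_finsetSum,
            Finset.sum_mul, NNReal.finsetProd_rpow, ENNReal.coe_rpow_of_nonneg _ r.coe_nonneg]
      _ = ((∑ i, ρ i ^ (r : ℝ)) ^ k : ℝ≥0) * D ^ (r : ℝ) := by rw [Fintype.sum_pow]
      _ ≤ D ^ (r : ℝ) :=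
          mul_le_of_le_one_left' (by exact_mod_cast pow_le_one₀ zero_le hsum)
  have hμ : μH[(r : ℝ)] (univ : Set Y) ≤ D ^ (r : ℝ) :=
    (Measure.hausdorffMeasure_le_liminf_sum (r : ℝ) univ u hu
      (fun k (w : Fin k → ι) => range (cylinderMap φ w)) (.of_forall hdiam)
      (.of_forall fun k y _ => mem_iUnion.2 (exists_cylinderMap_eq hcover k y))).trans
    (liminf_le_of_le (by isBoundedDefault) fun b hb => by
      obtain ⟨k, hk⟩ := hb.exists
      exact hk.trans (hbound k))
  exact dimH_le_of_hausdorffMeasure_ne_top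
    (hμ.trans_lt (ENNReal.rpow_lt_top_of_nonneg r.coe_nonneg
      (Bornology.IsBounded.all (univ : Set Y)).ediam_ne_top)).ne

end Cylinder

/-- A family of similitudes `φ i` of a metric space into itself, with ratios `ρ i`, whose ranges
pairwise meet in at most one point. -/
structure IsSimilarityPacking {Y ι : Type*} [MetricSpace Y] (φ : ι → Y → Y) (ρ : ι → ℝ≥0) :
    Prop where
  pos : ∀ i, 0 < ρ i
  nndist_map : ∀ i x y, nndist (φ i x) (φ i y) = ρ i * nndist x y
  subsingleton_inter : Pairwise fun i j => (range (φ i) ∩ range (φ j)).Subsingleton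

/-- The cost of the chain `x 0, …, x n`: the sum of the `r`-th powers of the lengths of its
jumps. -/
noncomputable def chainCost {Y : Type*} [PseudoMetricSpace Y] (r : ℝ) (x : ℕ → Y) (n : ℕ) : ℝ≥0 :=
  ∑ i ∈ Finset.range n, nndist (x i) (x (i + 1)) ^ r

namespace IsSimilarityPacking

variable {Y ι : Type*} [MetricSpace Y] {φ : ι → Y → Y} {ρ : ι → ℝ≥0}

theorem lipschitzWith (h : IsSimilarityPacking φ ρ) (i : ι) : LipschitzWith (ρ i) (φ i) :=
  .of_dist_le_mul fun x y => NNReal.coe_le_coe.2 (h.nndist_map i x y).le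

theorem injective (h : IsSimilarityPacking φ ρ) (i : ι) : Injective (φ i) :=
  Dilation.injective (Dilation.mkOfNNDistEq (φ i) ⟨ρ i, (h.pos i).ne', h.nndist_map i⟩)

theorem comp_left (h : IsSimilarityPacking φ ρ) {ψ : Y → Y} {σ : ℝ≥0} (hσ : 0 < σ)
    (hψ : ∀ x y, nndist (ψ x) (ψ y) = σ * nndist x y) :
    IsSimilarityPacking (fun i => ψ ∘ φ i) fun i => σ * ρ i where
  pos i := mul_pos hσ (h.pos i)
  nndist_map i x y := by simp only [comp_apply, hψ, h.nndist_map, mul_assoc]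
  subsingleton_inter i j hij := by
    have hinj : Injective ψ :=
      Dilation.injective (Dilation.mkOfNNDistEq ψ ⟨σ, hσ.ne', hψ⟩)
    simp only [range_comp ψ, ← image_inter hinj]
    exact (h.subsingleton_inter hij).image ψ

theorem iterate (h : IsSimilarityPacking φ ρ) (k : ℕ) :
    IsSimilarityPacking (fun w : Fin k → ι => cylinderMap φ w) fun w => ∏ i, ρ (w i) := by
  refine ⟨fun w => Finset.prod_pos fun i _ => h.pos (w i), ?_, ?_⟩
  · induction k with
    | zero => exact fun w x y => by simp [cylinderMap]
    | succ k ih =>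
      intro w x y
      rw [Fin.prod_univ_succ, mul_assoc]
      exact (h.nndist_map _ _ _).trans (congrArg _ (ih (Fin.tail w) x y))
  · induction k with
    | zero => exact fun w w' hne => (hne (Subsingleton.elim w w')).elim
    | succ k ih =>
      intro w w' hne
      by_cases hhead : w 0 = w' 0
      · have htail : Fin.tail w ≠ Fin.tail w' := fun htail => hne <| by
          rw [← Fin.cons_self_tail w, ← Fin.cons_self_tail w', hhead, htail]
        simp only [cylinderMap, hhead, range_comp (φ (w' 0)),
          ← image_inter (h.injective (w' 0))]
        exact (ih htail).image _
      · exact (h.subsingleton_inter hhead).anti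
          (inter_subset_inter (range_comp_subset_range _ _) (range_comp_subset_range _ _))

theorem sum_Ico_nndist_rpow (h : IsSimilarityPacking φ ρ) (j : ι) (r : ℝ) {x y : ℕ → Y} {k m : ℕ}
    (hy : ∀ i ≤ m, φ j (y i) = x (k + i)) :
    ∑ i ∈ Finset.Ico k (k + m), nndist (x i) (x (i + 1)) ^ r = ρ j ^ r * chainCost r y m := by
  rw [Finset.sum_Ico_eq_sum_range, chainCost, Finset.mul_sum, Nat.add_sub_cancel_left]
  refine Finset.sum_congr rfl fun i hi => ?_
  have hi := Finset.mem_range.1 hi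
  rw [add_assoc, ← hy i hi.le, ← hy (i + 1) hi, h.nndist_map, NNReal.mul_rpow]

theorem sum_rpow_mul_chainCost_le [Fintype ι] (h : IsSimilarityPacking φ ρ) {r : ℝ} (hr : 0 < r)
    {x : ℕ → Y} {n : ℕ} {k m : ι → ℕ} {y : ι → ℕ → Y} (hkm : ∀ j, k j + m j ≤ n)
    (hy : ∀ j, ∀ i ≤ m j, φ j (y j i) = x (k j + i)) :
    ∑ j, ρ j ^ r * chainCost r (y j) (m j) ≤ chainCost r x n := by
  classical
  let J (j : ι) : Finset ℕ := {i ∈ Finset.Ico (k j) (k j + m j) | x i ≠ x (i + 1)}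
  have hJ (j : ι) {i : ℕ} (hi : i ∈ J j) :
      i < n ∧ x i ∈ range (φ j) ∧ x (i + 1) ∈ range (φ j) := by
    have hi := Finset.mem_Ico.1 (Finset.mem_filter.1 hi).1
    obtain ⟨d, rfl⟩ := Nat.exists_eq_add_of_le hi.1
    have := hkm j
    exact ⟨by omega, ⟨_, hy j d (by omega)⟩, ⟨_, hy j (d + 1) (by omega)⟩⟩
  -- Ranges share at most one point, so an edge lying in two of them has length zero.
  have hdisj : PairwiseDisjoint (↑(Finset.univ : Finset ι)) J := fun j _ j' _ hjj' =>
    Finset.disjoint_left.2 fun i hi hi' => (Finset.mem_filter.1 hi).2 <|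
      h.subsingleton_inter hjj' ⟨(hJ j hi).2.1, (hJ j' hi').2.1⟩ ⟨(hJ j hi).2.2, (hJ j' hi').2.2⟩
  calc ∑ j, ρ j ^ r * chainCost r (y j) (m j)
      = ∑ j, ∑ i ∈ J j, nndist (x i) (x (i + 1)) ^ r := by
        refine Finset.sum_congr rfl fun j _ => ?_
        rw [← h.sum_Ico_nndist_rpow j r (hy j), Finset.sum_filter_of_ne]
        intro i _ hi hx
        rw [← hx, nndist_self, NNReal.zero_rpow hr.ne'] at hi
        exact hi rfl
    _ = ∑ i ∈ Finset.univ.biUnion J, nndist (x i) (x (i + 1)) ^ r :=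
        (Finset.sum_biUnion hdisj).symm
    _ ≤ chainCost r x n := Finset.sum_le_sum_of_subset fun i hi => by
        obtain ⟨j, -, hi⟩ := Finset.mem_biUnion.1 hi
        exact Finset.mem_range.2 (hJ j hi).1

end IsSimilarityPacking

section ChainCost

variable {Y : Type*} [PseudoMetricSpace Y]

theorem nndist_rpow_le_chainCost (r : ℝ) (x : ℕ → Y) {i n : ℕ} (hi : i < n) :
    nndist (x i) (x (i + 1)) ^ r ≤ chainCost r x n :=
  Finset.single_le_sum (f := fun i => nndist (x i) (x (i + 1)) ^ r) (fun _ _ => zero_le)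
    (Finset.mem_range.2 hi)

theorem chainCost_reverse (r : ℝ) (x : ℕ → Y) (n : ℕ) :
    chainCost r (fun i => x (n - i)) n = chainCost r x n := by
  rw [chainCost, chainCost, ← Finset.sum_range_reflect]
  refine Finset.sum_congr rfl fun i hi => ?_
  have hi := Finset.mem_range.1 hi
  rw [show n - (n - 1 - i) = i + 1 by omega, show n - (n - 1 - i + 1) = i by omega, nndist_comm]

end ChainCost

section Crossing

/-- One of the points `s`, `t` is at most `a` and the other one at least `b`. -/
def Crosses {α : Type*} [LE α] (a b s t : α) : Prop :=
  (s ≤ a ∧ b ≤ t) ∨ (b ≤ s ∧ t ≤ a)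

theorem exists_crossing_subchain {α : Type*} [LinearOrder α] {p p' q q' : α} (hpq : p ≤ q)
    (hp'q : p' ≤ q) (t : ℕ → α) (n : ℕ) (h0 : t 0 < p) (hn : q < t n)
    (hin : ∀ i < n, t i < p → t (i + 1) ≤ p') (hout : ∀ i < n, q < t (i + 1) → q' ≤ t i) :
    ∃ k m, 0 < k ∧ k + m < n ∧ (∀ i ≤ m, t (k + i) ∈ Icc p q) ∧ t k ≤ p' ∧ q' ≤ t (k + m) := by
  classical
  -- `b` is the first index above `q`, and `a` the last one before it below `p`.
  have hex : ∃ b, q < t b := ⟨n, hn⟩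
  set b := Nat.find hex
  have hb : q < t b := Nat.find_spec hex
  have hb_min : ∀ i < b, t i ≤ q := fun i hi => not_lt.1 (Nat.find_min hex hi)
  have hbn : b ≤ n := Nat.find_min' hex hn
  have hb_pos : 0 < b := Nat.pos_of_ne_zero fun hb0 =>
    (hb.trans (hb0 ▸ h0)).not_ge hpq
  set a := Nat.findGreatest (fun i => t i < p) (b - 1)
  have ha : t a < p := Nat.findGreatest_spec (P := fun i => t i < p) (Nat.zero_le (b - 1)) h0
  have hab : a ≤ b - 1 := Nat.findGreatest_le _
  have ha_max : ∀ i, a < i → i ≤ b - 1 → p ≤ t i := fun i h1 h2 =>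
    not_lt.1 (Nat.findGreatest_is_greatest (P := fun i => t i < p) h1 h2)
  have ha_next : t (a + 1) ≤ p' := hin a (by omega) ha
  have hne : a + 1 ≠ b := fun e => (e ▸ ha_next).not_gt (hp'q.trans_lt hb)
  refine ⟨a + 1, b - 1 - (a + 1), by omega, by omega,
    fun i hi => ⟨ha_max _ (by omega) (by omega), hb_min _ (by omega)⟩, ha_next, ?_⟩
  rw [Nat.add_sub_of_le (by omega)]
  exact hout _ (by omega) (by rwa [Nat.sub_add_cancel hb_pos])

theorem exists_pullback_chain_of_strictMono {ψ : unitInterval → unitInterval} (hψ : Continuous ψ)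
    (hm : StrictMono ψ) {a b : unitInterval} (ha : 0 < a) (hb : b < 1) :
    ∃ δ > 0, ∀ (t : ℕ → unitInterval) (n : ℕ), (∀ i < n, dist (t i) (t (i + 1)) < δ) →
      t 0 < ψ 0 → ψ 1 < t n →
      ∃ (k m : ℕ) (τ : ℕ → unitInterval), 0 < k ∧ k + m < n ∧ (∀ i ≤ m, ψ (τ i) = t (k + i)) ∧
        τ 0 ≤ a ∧ b ≤ τ m := by
  refine ⟨min (ψ a - ψ 0) (ψ 1 - ψ b), lt_min (sub_pos.2 (hm ha)) (sub_pos.2 (hm hb)),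
    fun t n hjump h0 hn => ?_⟩
  have hclose (i : ℕ) (hi : i < n) :
      (t (i + 1) : ℝ) - t i < ψ a - ψ 0 ∧ (t (i + 1) : ℝ) - t i < ψ 1 - ψ b := by
    rw [← lt_min_iff]
    have := hjump i hi
    rw [dist_comm, Subtype.dist_eq, Real.dist_eq] at this
    exact (le_abs_self _).trans_lt this
  obtain ⟨k, m, hk, hkm, hI, hstart, hend⟩ := exists_crossing_subchain (p' := ψ a) (q' := ψ b)
    (hm.monotone unitInterval.nonneg') (hm.monotone unitInterval.le_one') t n h0 hn
    (fun i hi hlt => Subtype.coe_le_coe.1 (by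
      linarith [(hclose i hi).1, Subtype.coe_lt_coe.2 hlt]))
    (fun i hi hlt => Subtype.coe_le_coe.1 (by
      linarith [(hclose i hi).2, Subtype.coe_lt_coe.2 hlt]))
  have hτ (i : ℕ) (hi : i ≤ m) : ψ (invFun ψ (t (k + i))) = t (k + i) := by
    obtain ⟨s, -, hs⟩ := intermediate_value_Icc zero_le_one hψ.continuousOn (hI i hi)
    exact invFun_eq ⟨s, hs⟩
  refine ⟨k, m, fun i => invFun ψ (t (k + i)), hk, hkm, hτ, ?_, ?_⟩
  · exact hm.le_iff_le.1 ((hτ 0 (Nat.zero_le m)).trans_le hstart)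
  · exact hm.le_iff_le.1 (hend.trans_eq (hτ m le_rfl).symm)

theorem exists_pullback_chain_of_injective {ψ : unitInterval → unitInterval} (hψ : Continuous ψ)
    (hinj : Injective ψ) {a b : unitInterval} (ha : 0 < a) (hb : b < 1) :
    ∃ δ > 0, ∀ (t : ℕ → unitInterval) (n : ℕ), (∀ i < n, dist (t i) (t (i + 1)) < δ) →
      (∀ s, t 0 < ψ s) → (∀ s, ψ s < t n) →
      ∃ (k m : ℕ) (τ : ℕ → unitInterval), 0 < k ∧ k + m < n ∧ (∀ i ≤ m, ψ (τ i) = t (k + i)) ∧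
        Crosses a b (τ 0) (τ m) := by
  rcases hψ.strictMono_of_inj hinj with hm | hm
  · obtain ⟨δ, hδ, H⟩ := exists_pullback_chain_of_strictMono hψ hm ha hb
    refine ⟨δ, hδ, fun t n hjump h0 hn => ?_⟩
    obtain ⟨k, m, τ, hk, hkm, hτ, hends⟩ := H t n hjump (h0 0) (hn 1)
    exact ⟨k, m, τ, hk, hkm, hτ, Or.inl hends⟩
  · obtain ⟨δ, hδ, H⟩ := exists_pullback_chain_of_strictMono (ψ := ψ ∘ unitInterval.symm)
      (hψ.comp unitInterval.continuous_symm) (hm.comp unitInterval.strictAnti_symm)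
      (a := unitInterval.symm b) (b := unitInterval.symm a)
      (unitInterval.lt_symm_comm.2 (by simpa using hb))
      (unitInterval.symm_lt_comm.2 (by simpa using ha))
    refine ⟨δ, hδ, fun t n hjump h0 hn => ?_⟩
    obtain ⟨k, m, τ, hk, hkm, hτ, hstart, hend⟩ := H t n hjump (h0 _) (hn _)
    exact ⟨k, m, fun i => unitInterval.symm (τ i), hk, hkm, hτ,
      Or.inr ⟨unitInterval.le_symm_comm.1 hstart, unitInterval.symm_le_comm.1 hend⟩⟩

theorem exists_pullback_chain {Y : Type*} [MetricSpace Y] (γ : unitInterval ≃ₜ Y) {φ : Y → Y}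
    (hφ : Continuous φ) (hinj : Injective φ) {a b : unitInterval} (ha : 0 < a) (hb : b < 1) :
    ∃ δ > 0, ∀ (x : ℕ → Y) (n : ℕ), (∀ i < n, nndist (x i) (x (i + 1)) < δ) →
      (∀ y, γ.symm (x 0) < γ.symm (φ y)) → (∀ y, γ.symm (φ y) < γ.symm (x n)) →
      ∃ (k m : ℕ) (y : ℕ → Y), 0 < k ∧ k + m < n ∧ (∀ i ≤ m, φ (y i) = x (k + i)) ∧
        Crosses a b (γ.symm (y 0)) (γ.symm (y m)) := by
  have := γ.compactSpace
  obtain ⟨ε, hε, H⟩ := exists_pullback_chain_of_injective (ψ := γ.symm ∘ φ ∘ γ)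
    (by fun_prop) (γ.symm.injective.comp (hinj.comp γ.injective)) ha hb
  obtain ⟨δ, hδ, hunif⟩ := Metric.uniformContinuous_iff.1
    (CompactSpace.uniformContinuous_of_continuous γ.symm.continuous) ε hε
  refine ⟨⟨δ, hδ.le⟩, hδ, fun x n hjump h0 hn => ?_⟩
  obtain ⟨k, m, τ, hk, hkm, hτ, hcross⟩ := H (γ.symm ∘ x) n
    (fun i hi => hunif (NNReal.coe_lt_coe.2 (hjump i hi))) (fun s => h0 _) (fun s => hn _)
  exact ⟨k, m, γ ∘ τ, hk, hkm, fun i hi => γ.symm.injective (hτ i hi), by simpa using hcross⟩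

end Crossing

section ChainSeparated

/-- Any two distinct points have a positive lower bound for the `r`-costs of the chains joining
them. -/
def IsChainSeparated (Y : Type*) [PseudoMetricSpace Y] (r : ℝ) : Prop :=
  ∀ ⦃y z : Y⦄, y ≠ z → ∃ c > 0, ∀ (x : ℕ → Y) (n : ℕ), x 0 = y → x n = z → c ≤ chainCost r x n

variable {Y : Type*} [MetricSpace Y]

-- A chain with small jumps from one side of `(a, b)` to the other contains a copy of a shorter
-- such chain in each piece of the packing, so the bound passes from the shorter chains to it.
theorem IsSimilarityPacking.exists_pos_le_chainCost {κ : Type*} [Fintype κ] {φ : κ → Y → Y}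
    {σ : κ → ℝ≥0} (h : IsSimilarityPacking φ σ) (γ : unitInterval ≃ₜ Y) {a b : unitInterval}
    (ha : 0 < a) (hb : b < 1) (hmem : ∀ j y, γ.symm (φ j y) ∈ Ioo a b) {r : ℝ} (hr : 0 < r)
    (hsum : 1 ≤ ∑ j, σ j ^ r) :
    ∃ c > 0, ∀ (n : ℕ) (x : ℕ → Y), Crosses a b (γ.symm (x 0)) (γ.symm (x n)) →
      c ≤ chainCost r x n := by
  have hne : Nonempty κ := by
    by_contra hempty
    rw [not_nonempty_iff] at hempty
    simp at hsum
  choose δ hδ H using fun j =>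
    exists_pullback_chain γ (h.lipschitzWith j).continuous (h.injective j) ha hb
  obtain ⟨j₀, hj₀⟩ := Finite.exists_min δ
  refine ⟨δ j₀ ^ r, NNReal.rpow_pos (hδ j₀), fun n => ?_⟩
  induction n using Nat.strong_induction_on with
  | _ n ih =>
    have forward (x : ℕ → Y) (h0 : γ.symm (x 0) ≤ a) (hn : b ≤ γ.symm (x n)) :
        δ j₀ ^ r ≤ chainCost r x n := by
      by_cases! hjump : ∃ i < n, δ j₀ ≤ nndist (x i) (x (i + 1))
      · obtain ⟨i, hin, hle⟩ := hjump
        exact (NNReal.rpow_le_rpow hle hr.le).trans (nndist_rpow_le_chainCost r x hin)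
      choose k m y hk hkm hy hcross using fun j => H j x n
        (fun i hi => (hjump i hi).trans_le (hj₀ j))
        (fun y => h0.trans_lt (hmem j y).1) (fun y => (hmem j y).2.trans_le hn)
      calc δ j₀ ^ r ≤ (∑ j, σ j ^ r) * δ j₀ ^ r := le_mul_of_one_le_left' hsum
        _ = ∑ j, σ j ^ r * δ j₀ ^ r := Finset.sum_mul ..
        _ ≤ ∑ j, σ j ^ r * chainCost r (y j) (m j) := by
            gcongr with j
            exact ih (m j) (by have := hkm j; have := hk j; omega) (y j) (hcross j)
        _ ≤ chainCost r x n := h.sum_rpow_mul_chainCost_le hr (fun j => (hkm j).le) hy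
    rintro x (⟨h0, hn⟩ | ⟨h0, hn⟩)
    · exact forward x h0 hn
    · rw [← chainCost_reverse]
      exact forward _ (by simpa using hn) (by simpa using h0)

theorem IsSimilarityPacking.exists_packing_subset {ι : Type*} [Fintype ι] [BoundedSpace Y]
    {φ : ι → Y → Y} {ρ : ι → ℝ≥0} (h : IsSimilarityPacking φ ρ) (hρ : ∀ i, ρ i < 1)
    (hcover : ∀ y, ∃ i x, φ i x = y) {r : ℝ} (hsum : 1 < ∑ i, ρ i ^ r)
    {U : Set Y} (hU : IsOpen U) (hne : U.Nonempty) :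
    ∃ (k : ℕ) (φ' : (Fin k → ι) → Y → Y) (σ : (Fin k → ι) → ℝ≥0), IsSimilarityPacking φ' σ ∧
      1 ≤ ∑ w, σ w ^ r ∧ ∀ w y, φ' w y ∈ U := by
  obtain ⟨l, v, hv⟩ := exists_range_cylinderMap_subset h.lipschitzWith hρ hcover hU hne
  set τ := ∏ i, ρ (v i)
  have hτ : 0 < τ := (h.iterate l).pos v
  obtain ⟨k, hk⟩ : ∃ k : ℕ, (τ ^ r)⁻¹ < (∑ i, ρ i ^ r) ^ k := pow_unbounded_of_one_lt _ hsum
  refine ⟨k, _, _, (h.iterate k).comp_left hτ ((h.iterate l).nndist_map v), ?_,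
    fun w y => hv (mem_range_self _)⟩
  calc 1 = τ ^ r * (τ ^ r)⁻¹ := (mul_inv_cancel₀ (NNReal.rpow_pos hτ).ne').symm
    _ ≤ τ ^ r * (∑ i, ρ i ^ r) ^ k := by gcongr
    _ = ∑ w : Fin k → ι, (τ * ∏ i, ρ (w i)) ^ r := by
        simp only [Fintype.sum_pow, Finset.mul_sum, NNReal.mul_rpow, NNReal.finsetProd_rpow]

theorem IsSimilarityPacking.isChainSeparated {ι : Type*} [Fintype ι] {φ : ι → Y → Y}
    {ρ : ι → ℝ≥0} (h : IsSimilarityPacking φ ρ) (hρ : ∀ i, ρ i < 1)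
    (hcover : ∀ y, ∃ i x, φ i x = y) (γ : unitInterval ≃ₜ Y) {r : ℝ} (hr : 0 < r)
    (hsum : 1 < ∑ i, ρ i ^ r) : IsChainSeparated Y r := by
  have := γ.compactSpace
  -- Crossing is symmetric in the end points, so the order of `y` and `z` along the arc is
  -- immaterial.
  suffices hlt : ∀ y z : Y, γ.symm y < γ.symm z → ∃ c > 0, ∀ (n : ℕ) (x : ℕ → Y),
      Crosses (γ.symm y) (γ.symm z) (γ.symm (x 0)) (γ.symm (x n)) → c ≤ chainCost r x n by
    intro y z hyz
    rcases (γ.symm.injective.ne hyz).lt_or_gt with hlt' | hlt'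
    · obtain ⟨c, hc, hle⟩ := hlt y z hlt'
      refine ⟨c, hc, ?_⟩
      rintro x n rfl rfl
      exact hle n x (.inl ⟨le_rfl, le_rfl⟩)
    · obtain ⟨c, hc, hle⟩ := hlt z y hlt'
      refine ⟨c, hc, ?_⟩
      rintro x n rfl rfl
      exact hle n x (.inr ⟨le_rfl, le_rfl⟩)
  intro y z hyz
  obtain ⟨a, hya, haz⟩ := exists_between hyz
  obtain ⟨b, hab, hbz⟩ := exists_between haz
  obtain ⟨k, φ', σ, h', hsum', hmem⟩ := h.exists_packing_subset hρ hcover hsum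
    (isOpen_Ioo.preimage γ.symm.continuous)
    ((nonempty_Ioo.2 hab).preimage γ.symm.surjective)
  obtain ⟨c, hc, hle⟩ := h'.exists_pos_le_chainCost γ (unitInterval.nonneg'.trans_lt hya)
    (hbz.trans_le unitInterval.le_one') hmem hr hsum'
  refine ⟨c, hc, fun n x hx => hle n x ?_⟩
  exact hx.imp (.imp (·.trans hya.le) hbz.le.trans) (.imp hbz.le.trans (·.trans hya.le))

end ChainSeparated

section HolderFunction

-- The functionals killing one vector form a closed proper subspace, hence Baire's theorem applies.
theorem exists_dual_forall_ne_zero {V ι : Type*} [NormedAddCommGroup V] [NormedSpace ℝ V]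
    [Countable ι] (v : ι → V) (hv : ∀ i, v i ≠ 0) : ∃ L : V →L[ℝ] ℝ, ∀ i, L (v i) ≠ 0 := by
  by_contra! hcon
  let K (i : ι) : Submodule ℝ (V →L[ℝ] ℝ) := (ContinuousLinearMap.apply ℝ ℝ (v i)).ker
  obtain ⟨i, hi⟩ := nonempty_interior_of_iUnion_of_closed (f := fun i => (K i : Set (V →L[ℝ] ℝ)))
    (fun i => (ContinuousLinearMap.apply ℝ ℝ (v i)).isClosed_ker)
    (eq_univ_of_forall fun L => mem_iUnion.2 (hcon L))
  obtain ⟨L, hL⟩ := SeparatingDual.exists_ne_zero (R := ℝ) (hv i)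
  have hmem : L ∈ K i := (K i).eq_top_of_nonempty_interior' hi ▸ Submodule.mem_top
  exact hL hmem

theorem exists_lipschitzWith_injOn_range {X : Type*} [MetricSpace X] (x : ℕ → X) :
    ∃ (K : ℝ≥0) (g : X → ℝ), LipschitzWith K g ∧ InjOn g (range x) := by
  let e := KuratowskiEmbedding.embeddingOfSubset x
  have he (m : ℕ) (y : X) (h : e (x m) = e y) : x m = y := by
    have hm := congrArg (fun z => z m) h
    simp only [e, KuratowskiEmbedding.embeddingOfSubset_coe, dist_self, sub_left_inj] at hm
    exact (dist_eq_zero.1 hm.symm).symm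
  obtain ⟨L, hL⟩ := exists_dual_forall_ne_zero
    (fun p : {p : ℕ × ℕ // x p.1 ≠ x p.2} => e (x p.1.1) - e (x p.1.2))
    fun p => sub_ne_zero.2 fun h => p.2 (he _ _ h)
  refine ⟨‖L‖₊ * 1, L ∘ e, L.lipschitz.comp (.of_dist_le_mul fun y z => ?_), ?_⟩
  · simpa using KuratowskiEmbedding.embeddingOfSubset_dist_le x y z
  · rintro _ ⟨m, rfl⟩ _ ⟨n, rfl⟩ h
    by_contra hmn
    exact hL ⟨(m, n), hmn⟩ ((map_sub L _ _).trans (sub_eq_zero.2 h))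

theorem exists_chain_of_list {Y : Type*} (d : Y → Y → ℝ≥0) (l : List Y) (y z : Y) :
    ∃ (n : ℕ) (x : ℕ → Y), x 0 = y ∧ x n = z ∧
      (List.zipWith d (y :: l) (l ++ [z])).sum = ∑ i ∈ Finset.range n, d (x i) (x (i + 1)) := by
  induction l generalizing y with
  | nil => exact ⟨1, fun i => if i = 0 then y else z, by simp, by simp, by simp⟩
  | cons u l ih =>
    obtain ⟨n, x, h0, hn, hs⟩ := ih u
    refine ⟨n + 1, fun i => Nat.casesOn i y x, rfl, hn, ?_⟩
    rw [Finset.sum_range_succ', List.cons_append, List.zipWith_cons_cons, List.sum_cons, hs,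
      add_comm, ← h0]
    rfl

universe u

variable {Y : Type u} [MetricSpace Y] {r : ℝ≥0}

-- The target is `Y` with the distance given by the infimum of the costs of the chains.
theorem IsChainSeparated.exists_injective_holderWith (h : IsChainSeparated Y r) (hr : 0 < r) :
    ∃ (X : Type u) (_ : MetricSpace X) (e : Y → X), Injective e ∧ HolderWith 1 r e := by
  let d (y z : Y) : ℝ≥0 := nndist y z ^ (r : ℝ)
  have hself (y : Y) : d y y = 0 := by simp [d, hr.ne']
  have hcomm (y z : Y) : d y z = d z y := by simp [d, nndist_comm]
  have hd (y z : Y) : (d y z : ℝ≥0∞) = edist y z ^ (r : ℝ) := by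
    rw [edist_nndist, ENNReal.coe_rpow_of_nonneg _ r.coe_nonneg]
  let P := PseudoMetricSpace.ofPreNNDist d hself hcomm
  refine ⟨Y, { P with eq_of_dist_eq_zero := fun {y z} hyz => ?_ }, id, injective_id,
    fun y z => ?_⟩
  · by_contra hne
    obtain ⟨c, hc, hle⟩ := h hne
    refine (hc.trans_le (le_ciInf fun l => ?_)).ne' (NNReal.coe_eq_zero.1 hyz)
    obtain ⟨n, x, h0, hn, hs⟩ := exists_chain_of_list d l y z
    exact hs ▸ hle x n h0 hn
  · rw [ENNReal.coe_one, one_mul, ← hd, edist_le_coe]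
    exact PseudoMetricSpace.dist_ofPreNNDist_le d hself hcomm y z

theorem IsChainSeparated.exists_holderWith_injOn_range (h : IsChainSeparated Y r) (hr : 0 < r)
    (x : ℕ → Y) : ∃ (C : ℝ≥0) (g : Y → ℝ), HolderWith C r g ∧ InjOn g (range x) := by
  obtain ⟨X, _, e, he, hHolder⟩ := h.exists_injective_holderWith hr
  obtain ⟨K, g, hg, hinj⟩ := exists_lipschitzWith_injOn_range (e ∘ x)
  have hcomp := hg.holderWith.comp hHolder
  rw [one_mul] at hcomp
  refine ⟨_, g ∘ e, hcomp, ?_⟩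
  exact hinj.comp he.injOn fun y ⟨n, hn⟩ => ⟨n, congrArg e hn⟩

/-- A function that is constant on no non-empty open set. -/
def NowhereConstant {Y Z : Type*} [TopologicalSpace Y] (f : Y → Z) : Prop :=
  ∀ V : Set Y, IsOpen V → V.Nonempty → (f '' V).Nontrivial

theorem NowhereConstant.exists_ne {Y Z : Type*} [TopologicalSpace Y] [Nonempty Y] {f : Y → Z}
    (hf : NowhereConstant f) : ∃ x y, f x ≠ f y := by
  obtain ⟨_, ⟨x, -, rfl⟩, _, ⟨y, -, rfl⟩, hxy⟩ := hf univ isOpen_univ univ_nonempty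
  exact ⟨x, y, hxy⟩

theorem nowhereConstant_of_injOn_dense {Y Z : Type*} [TopologicalSpace Y] [T1Space Y]
    [∀ y : Y, NeBot (𝓝[≠] y)] {f : Y → Z} {S : Set Y} (hS : Dense S) (hf : InjOn f S) :
    NowhereConstant f := by
  intro V hV hne
  obtain ⟨y, hyS, hyV⟩ := hS.exists_mem_open hV hne
  obtain ⟨z, hzS, hzV⟩ := (hS.sdiff_singleton y).exists_mem_open hV hne
  exact ⟨f y, mem_image_of_mem f hyV, f z, mem_image_of_mem f hzV, hf.ne hyS hzS.1 (Ne.symm hzS.2)⟩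

end HolderFunction

section Mollification

open ContinuousLinearMap
open scoped Convolution

variable {E : Type*} [NormedAddCommGroup E] [NormedSpace ℝ E]

/-- `v` is a mollification of `u` at scale `ε`: a `C¹` function whose value and derivative at `x`
are controlled by the oscillation of `u` on `ball x ε`. The oscillation is measured from an
arbitrary reference value `c`, and `A` is the constant lost in the derivative bound. -/
structure IsMollification (A ε : ℝ) (u v : E → ℝ) : Prop where
  contDiff : ContDiff ℝ 1 v
  abs_sub_le : ∀ {x c B}, (∀ y ∈ ball x ε, |u y - c| ≤ B) → |v x - c| ≤ B
  norm_fderiv_le : ∀ {x c B}, (∀ y ∈ ball x ε, |u y - c| ≤ B) → ‖fderiv ℝ v x‖ ≤ A * B / ε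

theorem IsMollification.rescale {A ε : ℝ} {u v : E → ℝ} (hε : 0 < ε)
    (h : IsMollification A 1 (fun x => u (ε • x)) v) :
    IsMollification A ε u fun x => v (ε⁻¹ • x) := by
  have hball : ∀ {x c B}, (∀ y ∈ ball x ε, |u y - c| ≤ B) →
      ∀ y ∈ ball (ε⁻¹ • x) 1, |u (ε • y) - c| ≤ B := fun {x c B} hB y hy => hB _ (by
    rw [← smul_inv_smul₀ hε.ne' x, mem_ball, dist_smul₀, Real.norm_of_nonneg hε.le]
    exact mul_lt_of_lt_one_right hε hy)
  refine ⟨h.contDiff.comp (contDiff_const_smul ε⁻¹), fun hB => h.abs_sub_le (hball hB),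
    fun {x c B} hB => ?_⟩
  have hunit := h.norm_fderiv_le (hball hB)
  rw [fderiv_comp_smul, norm_smul, Real.norm_of_nonneg (inv_nonneg.2 hε.le), div_eq_inv_mul]
  rw [div_one] at hunit
  gcongr

variable [FiniteDimensional ℝ E] [MeasurableSpace E] [BorelSpace E] {μ : Measure E}
  [μ.IsAddHaarMeasure]

-- The convolution of `w` with the constant function `1` is constant.
theorem integral_fderiv_eq_zero {w : E → ℝ} (hw : ContDiff ℝ 1 w) (hwc : HasCompactSupport w) :
    ∫ x, fderiv ℝ w x ∂μ = 0 := by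
  have hconv : w ⋆[lsmul ℝ ℝ, μ] (fun _ : E => (1 : ℝ)) = fun _ => ∫ x, w x ∂μ := by
    ext x
    simp only [convolution_def, lsmul_apply, smul_eq_mul, mul_one]
  have hderiv := hwc.hasFDerivAt_convolution_left (lsmul ℝ ℝ) hw
    (locallyIntegrable_const (μ := μ) (1 : ℝ)) 0
  rw [hconv] at hderiv
  have hflip : ((lsmul ℝ ℝ).precompL E).flip (1 : ℝ) = .id ℝ (E →L[ℝ] ℝ) := by
    ext
    simp [precompL_apply]
  calc ∫ x, fderiv ℝ w x ∂μ
      = ∫ x, ((lsmul ℝ ℝ).precompL E).flip 1 (fderiv ℝ w x) ∂μ := by rw [hflip]; rfl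
    _ = 0 := hderiv.unique (hasFDerivAt_const _ _)

set_option maxSynthPendingDepth 3 in
theorem norm_fderiv_convolution_le {w u : E → ℝ} {x : E} {c B R : ℝ} (hw : ContDiff ℝ 1 w)
    (hwc : HasCompactSupport w) (hsupp : tsupport w ⊆ ball 0 R) (hu : LocallyIntegrable u μ)
    (hB : 0 ≤ B) (h : ∀ y ∈ ball x R, |u y - c| ≤ B) :
    ‖fderiv ℝ (w ⋆[lsmul ℝ ℝ, μ] u) x‖ ≤ (∫ y, ‖fderiv ℝ w y‖ ∂μ) * B := by
  have hint : Integrable (fderiv ℝ w) μ :=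
    (hw.continuous_fderiv one_ne_zero).integrable_of_hasCompactSupport (hwc.fderiv ℝ)
  set L := (lsmul ℝ ℝ : ℝ →L[ℝ] ℝ →L[ℝ] ℝ).precompL E
  have hLnorm : ‖L‖ ≤ 1 := (norm_precompL_le E _).trans opNorm_lsmul_le
  have hmean : ∫ t, L (fderiv ℝ w t) c ∂μ = 0 := by
    have := (L.flip c).integral_comp_comm hint
    simpa only [flip_apply, integral_fderiv_eq_zero hw hwc, map_zero] using this
  have hdist := dist_convolution_le' L hB hint ((support_fderiv_subset ℝ).trans hsupp)
    hu.aestronglyMeasurable h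
  rw [(hwc.hasFDerivAt_convolution_left (lsmul ℝ ℝ) hw hu x).fderiv]
  rw [hmean, dist_zero_right] at hdist
  refine hdist.trans (mul_le_mul_of_nonneg_right ?_ hB)
  exact mul_le_of_le_one_left (integral_nonneg fun _ => norm_nonneg _) hLnorm

theorem locallyIntegrable_comp_smul {u : E → ℝ} (hu : LocallyIntegrable u μ) {a : ℝ} (ha : a ≠ 0) :
    LocallyIntegrable (fun x => u (a • x)) μ := by
  refine (locallyIntegrable_map_homeomorph (Homeomorph.smulOfNeZero a ha)).1 ?_
  have hmap : μ.map (Homeomorph.smulOfNeZero a ha) = _ := Measure.map_addHaar_smul μ ha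
  rw [hmap]
  intro x
  obtain ⟨U, hU, hint⟩ := hu x
  refine ⟨U, hU, ?_⟩
  rw [IntegrableOn, Measure.restrict_smul]
  exact hint.smul_measure ENNReal.ofReal_ne_top

variable (μ) in
theorem exists_isMollification_one :
    ∃ A : ℝ, 0 ≤ A ∧ ∀ u : E → ℝ, LocallyIntegrable u μ → ∃ v, IsMollification A 1 u v := by
  let φ : ContDiffBump (0 : E) := ⟨1 / 4, 1 / 2, by norm_num, by norm_num⟩
  let w : E → ℝ := φ.normed μ
  have hw : ContDiff ℝ 1 w := φ.contDiff_normed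
  have hwc : HasCompactSupport w := φ.hasCompactSupport_normed
  have hsupp : tsupport w ⊆ ball 0 1 := by
    rw [φ.tsupport_normed_eq]
    exact closedBall_subset_ball (by norm_num)
  refine ⟨∫ y, ‖fderiv ℝ w y‖ ∂μ, integral_nonneg fun _ => norm_nonneg _, fun u hu =>
    ⟨w ⋆[lsmul ℝ ℝ, μ] u, hwc.contDiff_convolution_left _ hw hu, fun hB => ?_, fun hB => ?_⟩⟩ <;>
    have hB₀ := (abs_nonneg _).trans (hB _ (mem_ball_self one_pos))
  · exact dist_convolution_le hB₀ ((subset_tsupport w).trans hsupp) φ.nonneg_normed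
      φ.integral_normed hu.aestronglyMeasurable hB
  · rw [div_one]
    exact norm_fderiv_convolution_le hw hwc hsupp hu hB₀ hB

variable (μ) in
theorem exists_isMollification :
    ∃ A : ℝ, 0 ≤ A ∧ ∀ u : E → ℝ, LocallyIntegrable u μ → ∀ ε, 0 < ε →
      ∃ v, IsMollification A ε u v := by
  obtain ⟨A, hA, hunit⟩ := exists_isMollification_one μ
  refine ⟨A, hA, fun u hu ε hε => ?_⟩
  obtain ⟨v, hv⟩ := hunit _ (locallyIntegrable_comp_smul hu hε.ne')
  exact ⟨_, hv.rescale hε⟩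

end Mollification

section WhitneyExtension

theorem exists_measurable_extension_of_holderWith {X : Type*} [PseudoMetricSpace X]
    [MeasurableSpace X] [OpensMeasurableSpace X] {K : Set X} [Nonempty K] {f : K → ℝ} {C r : ℝ≥0}
    (hf : HolderWith C r f) (hr : 1 ≤ r) :
    ∃ (C' : ℝ≥0) (g : X → ℝ), Measurable g ∧
      ∀ (z : K) (y : X), |g y - f z| ≤ C' * dist y z ^ (r : ℝ) := by
  set C' : ℝ≥0 := C * 2 ^ ((r : ℝ) - 1)
  have hlower : ∀ (y : X) (z x : K),
      f z - C' * dist y z ^ (r : ℝ) ≤ f x + C' * dist y x ^ (r : ℝ) := by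
    intro y z x
    have hpow : dist z x ^ (r : ℝ) ≤
        2 ^ ((r : ℝ) - 1) * (dist y z ^ (r : ℝ) + dist y x ^ (r : ℝ)) := by
      refine (Real.rpow_le_rpow dist_nonneg (dist_triangle_left (z : X) x y) r.2).trans ?_
      exact_mod_cast NNReal.rpow_add_le_mul_rpow_add_rpow (nndist y z) (nndist y x)
        (NNReal.one_le_coe.2 hr)
    have hfzx : f z - f x ≤ C * dist z x ^ (r : ℝ) := (le_abs_self _).trans (hf.dist_le z x)
    have hfzx' := hfzx.trans (mul_le_mul_of_nonneg_left hpow C.2)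
    push_cast [C']
    linarith
  have hbdd : ∀ y : X, BddBelow (range fun x : K => f x + C' * dist y x ^ (r : ℝ)) := fun y =>
    ⟨_, forall_mem_range.2 (hlower y (Classical.arbitrary K))⟩
  refine ⟨C', fun y => ⨅ x : K, (f x + C' * dist y x ^ (r : ℝ)), ?_, fun z y => ?_⟩
  · refine (upperSemicontinuous_ciInf hbdd fun x => Continuous.upperSemicontinuous ?_).measurable
    exact continuous_const.add (continuous_const.mul
      ((continuous_id.dist continuous_const).rpow_const fun _ => Or.inr r.2))
  · rw [abs_le]
    constructor
    · linarith [le_ciInf (hlower y z)]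
    · linarith [ciInf_le (hbdd y) z]

theorem abs_sub_le_of_mem_ball {X : Type*} [PseudoMetricSpace X] {K : Set X} {f : K → ℝ}
    {g : X → ℝ} {C r δ ε : ℝ} {x y : X} {z : K} (hg : ∀ (z : K) y, |g y - f z| ≤ C * dist y z ^ r)
    (hC : 0 ≤ C) (hr : 0 ≤ r) (hxz : dist x z < 3 * ε) (hδ : δ ≤ ε) (hy : y ∈ ball x δ) :
    |g y - f z| ≤ C * (4 * ε) ^ r := by
  have hyz : dist y z ≤ 4 * ε := by linarith [dist_triangle y x z, mem_ball.1 hy]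
  exact (hg z y).trans (by gcongr)

variable {E : Type*} [NormedAddCommGroup E] [NormedSpace ℝ E] {K : Set E} {A ε : ℝ}

/-- `χ` is a `C¹` cutoff function for the set `K` at scale `ε`: it is `1` to first order on `K`,
vanishes to first order at distance `3 * ε` from `K`, and its derivative is at most `A / ε`. -/
structure IsCutoff (A ε : ℝ) (K : Set E) (χ : E → ℝ) : Prop where
  contDiff : ContDiff ℝ 1 χ
  abs_le_one : ∀ x, |χ x| ≤ 1
  norm_fderiv_le : ∀ x, ‖fderiv ℝ χ x‖ ≤ A / ε
  eq_one : ∀ x ∈ K, χ x = 1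
  fderiv_eq_zero : ∀ x ∈ K, fderiv ℝ χ x = 0
  eq_zero_of_notMem : ∀ x ∉ thickening (3 * ε) K, χ x = 0
  fderiv_eq_zero_of_notMem : ∀ x ∉ thickening (3 * ε) K, fderiv ℝ χ x = 0

theorem IsMollification.isCutoff {χ : E → ℝ} (hε : 0 < ε)
    (h : IsMollification A ε ((thickening (2 * ε) K).indicator 1) χ) : IsCutoff A ε K χ := by
  set u : E → ℝ := (thickening (2 * ε) K).indicator 1
  have hle : ∀ x, ∀ y ∈ ball x ε, |u y - 0| ≤ 1 := fun x y _ => by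
    by_cases hy : y ∈ thickening (2 * ε) K <;> simp [u, hy]
  have hone : ∀ x ∈ K, ∀ y ∈ ball x ε, |u y - 1| ≤ 0 := fun x hx y hy => by
    have : y ∈ thickening (2 * ε) K :=
      mem_thickening_iff.2 ⟨x, hx, (mem_ball.1 hy).trans (by linarith)⟩
    simp [u, this]
  have hzero : ∀ x ∉ thickening (3 * ε) K, ∀ y ∈ ball x ε, |u y - 0| ≤ 0 := fun x hx y hy => by
    have : y ∉ thickening (2 * ε) K := fun hyK => by
      obtain ⟨z, hz, hyz⟩ := mem_thickening_iff.1 hyK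
      refine hx (mem_thickening_iff.2 ⟨z, hz, ?_⟩)
      linarith [dist_triangle_left x z y, mem_ball.1 hy]
    simp [u, this]
  exact
    { contDiff := h.contDiff
      abs_le_one := fun x => by simpa using h.abs_sub_le (hle x)
      norm_fderiv_le := fun x => by simpa using h.norm_fderiv_le (hle x)
      eq_one := fun x hx => by simpa [sub_eq_zero] using h.abs_sub_le (hone x hx)
      fderiv_eq_zero := fun x hx => by simpa using h.norm_fderiv_le (hone x hx)
      eq_zero_of_notMem := fun x hx => by simpa using h.abs_sub_le (hzero x hx)
      fderiv_eq_zero_of_notMem := fun x hx => by simpa using h.norm_fderiv_le (hzero x hx) }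

section CutoffMul

variable {χ H : E → ℝ} {x : E}

theorem IsCutoff.fderiv_mul (hχ : IsCutoff A ε K χ) (hH : ContDiff ℝ 1 H) (x : E) :
    fderiv ℝ (χ * H) x = χ x • fderiv ℝ H x + H x • fderiv ℝ χ x :=
  _root_.fderiv_mul (hχ.contDiff.differentiable one_ne_zero x) (hH.differentiable one_ne_zero x)

theorem IsCutoff.fderiv_mul_of_mem (hχ : IsCutoff A ε K χ) (hH : ContDiff ℝ 1 H) (hx : x ∈ K) :
    fderiv ℝ (χ * H) x = fderiv ℝ H x := by
  rw [hχ.fderiv_mul hH, hχ.eq_one x hx, hχ.fderiv_eq_zero x hx, one_smul, smul_zero, add_zero]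

theorem IsCutoff.abs_mul_le {B : ℝ} (hχ : IsCutoff A ε K χ) (hB : 0 ≤ B)
    (h : ∀ x ∈ thickening (3 * ε) K, |H x| ≤ B) (x : E) : |(χ * H) x| ≤ B := by
  rw [Pi.mul_apply, abs_mul]
  by_cases hx : x ∈ thickening (3 * ε) K
  · exact (mul_le_of_le_one_left (abs_nonneg _) (hχ.abs_le_one x)).trans (h x hx)
  · simpa [hχ.eq_zero_of_notMem x hx] using hB

theorem IsCutoff.norm_fderiv_mul_le {B D : ℝ} (hχ : IsCutoff A ε K χ) (hH : ContDiff ℝ 1 H)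
    (hB : 0 ≤ B) (hD : 0 ≤ D) (h : ∀ x ∈ thickening (3 * ε) K, |H x| ≤ B)
    (h' : ∀ x ∈ thickening (3 * ε) K, ‖fderiv ℝ H x‖ ≤ D) (x : E) :
    ‖fderiv ℝ (χ * H) x‖ ≤ D + B * (A / ε) := by
  have hAε : 0 ≤ A / ε := (norm_nonneg _).trans (hχ.norm_fderiv_le x)
  rw [hχ.fderiv_mul hH]
  by_cases hx : x ∈ thickening (3 * ε) K
  · calc ‖χ x • fderiv ℝ H x + H x • fderiv ℝ χ x‖
        ≤ |χ x| * ‖fderiv ℝ H x‖ + |H x| * ‖fderiv ℝ χ x‖ :=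
          (norm_add_le _ _).trans_eq (by simp only [norm_smul, Real.norm_eq_abs])
      _ ≤ 1 * D + B * (A / ε) := by
          gcongr
          exacts [hχ.abs_le_one x, h' x hx, h x hx, hχ.norm_fderiv_le x]
      _ = D + B * (A / ε) := by rw [one_mul]
  · rw [hχ.eq_zero_of_notMem x hx, hχ.fderiv_eq_zero_of_notMem x hx, zero_smul, smul_zero,
      add_zero, norm_zero]
    positivity

end CutoffMul

section Scales

variable {f : K → ℝ} {g G G' : E → ℝ} {C r : ℝ}

theorem IsMollification.abs_sub_le_of_two_scales {x : E} (hG : IsMollification A ε g G)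
    (hG' : IsMollification A (ε / 2) g G') (hg : ∀ (z : K) y, |g y - f z| ≤ C * dist y z ^ r)
    (hC : 0 ≤ C) (hr : 0 ≤ r) (hε : 0 < ε) (hx : x ∈ thickening (3 * ε) K) :
    |(G' - G) x| ≤ 2 * (C * (4 * ε) ^ r) := by
  obtain ⟨z, hz, hxz⟩ := mem_thickening_iff.1 hx
  have hval := hG.abs_sub_le fun y => abs_sub_le_of_mem_ball (z := ⟨z, hz⟩) hg hC hr hxz le_rfl
  have hval' := hG'.abs_sub_le fun y =>
    abs_sub_le_of_mem_ball (z := ⟨z, hz⟩) hg hC hr hxz (half_le_self hε.le)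
  rw [abs_sub_comm] at hval
  rw [Pi.sub_apply, two_mul]
  exact (_root_.abs_sub_le _ _ _).trans (add_le_add hval' hval)

theorem IsMollification.norm_fderiv_sub_le_of_two_scales {x : E} (hG : IsMollification A ε g G)
    (hG' : IsMollification A (ε / 2) g G') (hg : ∀ (z : K) y, |g y - f z| ≤ C * dist y z ^ r)
    (hC : 0 ≤ C) (hr : 0 ≤ r) (hε : 0 < ε) (hx : x ∈ thickening (3 * ε) K) :
    ‖fderiv ℝ (G' - G) x‖ ≤ 3 * A * (C * (4 * ε) ^ r / ε) := by
  obtain ⟨z, hz, hxz⟩ := mem_thickening_iff.1 hx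
  have hder := hG.norm_fderiv_le fun y =>
    abs_sub_le_of_mem_ball (z := ⟨z, hz⟩) hg hC hr hxz le_rfl
  have hder' := hG'.norm_fderiv_le fun y =>
    abs_sub_le_of_mem_ball (z := ⟨z, hz⟩) hg hC hr hxz (half_le_self hε.le)
  rw [fderiv_sub (hG'.contDiff.differentiable one_ne_zero x)
    (hG.contDiff.differentiable one_ne_zero x)]
  calc ‖fderiv ℝ G' x - fderiv ℝ G x‖
      ≤ A * (C * (4 * ε) ^ r) / (ε / 2) + A * (C * (4 * ε) ^ r) / ε :=
        (norm_sub_le _ _).trans (add_le_add hder' hder)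
    _ = 3 * A * (C * (4 * ε) ^ r / ε) := by field_simp; ring

theorem IsCutoff.norm_fderiv_mul_sub_le_of_two_scales {χ : E → ℝ} (hχ : IsCutoff A ε K χ)
    (hG : IsMollification A ε g G) (hG' : IsMollification A (ε / 2) g G')
    (hg : ∀ (z : K) y, |g y - f z| ≤ C * dist y z ^ r) (hA : 0 ≤ A) (hC : 0 ≤ C) (hr : 0 ≤ r)
    (hε : 0 < ε) (x : E) :
    ‖fderiv ℝ (χ * (G' - G)) x‖ ≤ 5 * A * (C * (4 * ε) ^ r / ε) := by
  refine (hχ.norm_fderiv_mul_le (hG'.contDiff.sub hG.contDiff) (by positivity) (by positivity)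
    (fun _ => hG.abs_sub_le_of_two_scales hG' hg hC hr hε)
    (fun _ => hG.norm_fderiv_sub_le_of_two_scales hG' hg hC hr hε) x).trans_eq ?_
  ring

end Scales

theorem exists_contDiff_of_summable_telescoping {G τ : ℕ → E → ℝ} {f : K → ℝ} {u : ℕ → ℝ}
    (hG : ContDiff ℝ 1 (G 0)) (hτ : ∀ j, ContDiff ℝ 1 (τ j)) (hu : Summable u)
    (hτu : ∀ j x, |τ j x| ≤ u j) (hτu' : ∀ j x, ‖fderiv ℝ (τ j) x‖ ≤ u j)
    (htel : ∀ j, ∀ z : K, τ j z = G (j + 1) z - G j z)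
    (htel' : ∀ j, ∀ z : K, fderiv ℝ (τ j) z = fderiv ℝ (G (j + 1)) z - fderiv ℝ (G j) z)
    (hlim : ∀ z : K, Tendsto (fun j => G j z) atTop (𝓝 (f z)))
    (hlim' : ∀ z : K, Tendsto (fun j => fderiv ℝ (G j) z) atTop (𝓝 0)) :
    ∃ F : E → ℝ, ContDiff ℝ 1 F ∧ ∀ z : K, F z = f z ∧ fderiv ℝ F z = 0 := by
  have hT : ContDiff ℝ 1 fun x => ∑' j, τ j x := by
    refine contDiff_tsum (N := 1) (v := fun _ => u) hτ (fun _ _ => hu) fun k j x hk => ?_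
    obtain rfl | rfl : k = 0 ∨ k = 1 := by
      have : k ≤ 1 := by exact_mod_cast hk
      omega
    · rw [norm_iteratedFDeriv_zero]
      exact hτu j x
    · rw [norm_iteratedFDeriv_one]
      exact hτu' j x
  refine ⟨fun x => G 0 x + ∑' j, τ j x, hG.add hT, fun z => ⟨?_, ?_⟩⟩
  · have hsum : HasSum (fun j => τ j z) (f z - G 0 z) := by
      refine (Summable.of_norm_bounded hu fun j => hτu j z).hasSum_iff_tendsto_nat.2 ?_
      simp only [htel, Finset.sum_range_sub fun j => G j z]
      exact (hlim z).sub_const _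
    simp only [hsum.tsum_eq, add_sub_cancel]
  · have hsum : HasSum (fun j => fderiv ℝ (τ j) z) (0 - fderiv ℝ (G 0) z) := by
      refine (Summable.of_norm_bounded hu fun j => hτu' j z).hasSum_iff_tendsto_nat.2 ?_
      simp only [htel', Finset.sum_range_sub fun j => fderiv ℝ (G j) z]
      exact (hlim' z).sub_const _
    have hfderiv : fderiv ℝ (fun x => ∑' j, τ j x) z = ∑' j, fderiv ℝ (τ j) z :=
      fderiv_tsum_apply hu (fun j => (hτ j).differentiable one_ne_zero) hτu'
        (Summable.of_norm_bounded hu fun j => hτu j z) _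
    rw [fderiv_fun_add (hG.differentiable one_ne_zero _) (hT.differentiable one_ne_zero _),
      hfderiv, hsum.tsum_eq, add_sub_cancel]

theorem summable_rpow_div_of_dyadic {r : ℝ} (hr : 1 < r) :
    Summable fun j : ℕ => (4 * (1 / 2 : ℝ) ^ j) ^ r / (1 / 2 : ℝ) ^ j := by
  have hgeom : ∀ j : ℕ, (4 * (1 / 2 : ℝ) ^ j) ^ r / (1 / 2 : ℝ) ^ j =
      4 ^ r * ((1 / 2 : ℝ) ^ (r - 1)) ^ j := fun j => by
    rw [Real.mul_rpow (by norm_num) (by positivity), ← Real.rpow_natCast_mul (by norm_num),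
      mul_comm (j : ℝ) r, Real.rpow_mul_natCast (by norm_num), Real.rpow_sub_one (by norm_num),
      div_pow _ (1 / 2 : ℝ), mul_div_assoc]
  simp only [hgeom]
  exact (summable_geometric_of_lt_one (by positivity)
    (Real.rpow_lt_one (by norm_num) (by norm_num) (by linarith))).mul_left _

variable [FiniteDimensional ℝ E]

theorem exists_isMollification_isCutoff [MeasurableSpace E] [BorelSpace E] [Nonempty K] {g : E → ℝ}
    {f : K → ℝ} {C r : ℝ} (hgm : Measurable g) (hr : 0 ≤ r)
    (hg : ∀ (z : K) y, |g y - f z| ≤ C * dist y z ^ r) :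
    ∃ A : ℝ, 0 ≤ A ∧ ∀ ε, 0 < ε →
      (∃ G, IsMollification A ε g G) ∧ ∃ χ, IsCutoff A ε K χ := by
  obtain ⟨A, hA, hmoll⟩ := exists_isMollification (Measure.addHaar : Measure E)
  refine ⟨A, hA, fun ε hε => ⟨hmoll g ?_ ε hε, ?_⟩⟩
  · let z : K := Classical.arbitrary K
    have hcont : Continuous fun y : E => |f z| + C * dist y z ^ r :=
      continuous_const.add (continuous_const.mul
        ((continuous_id.dist continuous_const).rpow_const fun _ => Or.inr hr))
    refine hcont.locallyIntegrable.mono hgm.aestronglyMeasurable (ae_of_all _ fun y => ?_)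
    calc ‖g y‖ = |f z + (g y - f z)| := by rw [add_sub_cancel, Real.norm_eq_abs]
      _ ≤ |f z| + C * dist y z ^ r := (abs_add_le _ _).trans (by gcongr; exact hg z y)
      _ ≤ ‖|f z| + C * dist y z ^ r‖ := le_abs_self _
  · obtain ⟨χ, hχ⟩ := hmoll ((thickening (2 * ε) K).indicator 1)
      ((locallyIntegrable_const 1).indicator isOpen_thickening.measurableSet) ε hε
    exact ⟨χ, hχ.isCutoff hε⟩

-- Glue the mollifications of `g` at the scales `2⁻ʲ` along cutoffs at the same scales.
theorem exists_contDiff_extension_of_measurable_extension [MeasurableSpace E] [BorelSpace E]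
    [Nonempty K] {g : E → ℝ} {f : K → ℝ} {C r : ℝ} (hgm : Measurable g) (hC : 0 ≤ C) (hr : 1 < r)
    (hg : ∀ (z : K) y, |g y - f z| ≤ C * dist y z ^ r) :
    ∃ F : E → ℝ, ContDiff ℝ 1 F ∧ ∀ z : K, F z = f z ∧ fderiv ℝ F z = 0 := by
  have hr₀ : 0 ≤ r := by linarith
  obtain ⟨A, hA, hscale⟩ := exists_isMollification_isCutoff hgm hr₀ hg
  let ε : ℕ → ℝ := fun j => (1 / 2) ^ j
  have hε : ∀ j, 0 < ε j := fun j => by positivity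
  choose G hG using fun j => (hscale (ε j) (hε j)).1
  choose χ hχ using fun j => (hscale (ε j) (hε j)).2
  have hG' : ∀ j, IsMollification A (ε j / 2) g (G (j + 1)) := fun j => by
    have : ε j / 2 = ε (j + 1) := by simp only [ε, pow_succ]; ring
    exact this ▸ hG (j + 1)
  have hH : ∀ j, ContDiff ℝ 1 (G (j + 1) - G j) := fun j => (hG _).contDiff.sub (hG j).contDiff
  let b : ℕ → ℝ := fun j => C * ((4 * ε j) ^ r / ε j)
  have hb : ∀ j, C * (4 * ε j) ^ r / ε j = b j := fun j => mul_div_assoc _ _ _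
  have hb₀ : ∀ j, 0 ≤ b j := fun j => by positivity
  have hBb : ∀ j, C * (4 * ε j) ^ r ≤ b j := fun j =>
    (hb j).symm ▸ le_div_self (by positivity) (hε j) (pow_le_one₀ (by norm_num) (by norm_num))
  have hbsum : Summable b := (summable_rpow_div_of_dyadic hr).mul_left C
  have hnear : ∀ j (z : K), ∀ y ∈ ball (z : E) (ε j), |g y - f z| ≤ C * (4 * ε j) ^ r :=
    fun j z y => abs_sub_le_of_mem_ball hg hC hr₀ (by simpa using hε j) le_rfl
  refine exists_contDiff_of_summable_telescoping (G := G) (τ := fun j => χ j * (G (j + 1) - G j))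
    (hG 0).contDiff (fun j => (hχ j).contDiff.mul (hH j)) (hbsum.mul_left (2 + 5 * A))
    (fun j x => ?_) (fun j x => ?_) (fun j z => ?_) (fun j z => ?_) (fun z => ?_) fun z => ?_
  · have hτ := (hχ j).abs_mul_le (by positivity)
      (fun y => (hG j).abs_sub_le_of_two_scales (hG' j) hg hC hr₀ (hε j)) x
    nlinarith [hBb j, mul_nonneg hA (hb₀ j)]
  · refine ((hχ j).norm_fderiv_mul_sub_le_of_two_scales (hG j) (hG' j) hg hA hC hr₀
      (hε j) x).trans ?_
    rw [hb]
    gcongr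
    linarith
  · simp only [Pi.mul_apply, (hχ j).eq_one z z.2, one_mul, Pi.sub_apply]
  · rw [(hχ j).fderiv_mul_of_mem (hH j) z.2, fderiv_sub
      ((hG _).contDiff.differentiable one_ne_zero _) ((hG j).contDiff.differentiable one_ne_zero _)]
  · refine tendsto_iff_dist_tendsto_zero.2 (squeeze_zero (fun _ => dist_nonneg) (fun j => ?_)
      hbsum.tendsto_atTop_zero)
    exact ((hG j).abs_sub_le (hnear j z)).trans (hBb j)
  · refine squeeze_zero_norm (fun j => (hG j).norm_fderiv_le (hnear j z)) ?_
    simpa only [mul_div_assoc, mul_zero] using (hbsum.tendsto_atTop_zero).const_mul A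

theorem exists_contDiff_extension_of_holderWith {f : K → ℝ} {C r : ℝ≥0} (hf : HolderWith C r f)
    (hr : 1 < r) :
    ∃ F : E → ℝ, ContDiff ℝ 1 F ∧ ∀ z : K, F z = f z ∧ fderiv ℝ F z = 0 := by
  borelize E
  cases isEmpty_or_nonempty K
  · exact ⟨0, contDiff_const, isEmptyElim⟩
  obtain ⟨C', g, hgm, hg⟩ := exists_measurable_extension_of_holderWith hf hr.le
  exact exists_contDiff_extension_of_measurable_extension hgm C'.2 (NNReal.one_lt_coe.2 hr) hg

end WhitneyExtension

section SelfSimilarArc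

variable {X : Type*}

theorem pairwise_subsingleton_inter_of_consecutive {l : ℕ} {s : Fin l → Set X}
    (hadj : ∀ i j : Fin l, (i : ℕ) + 1 = j → ∃ z, s i ∩ s j = {z})
    (hdisj : ∀ i j : Fin l, (i : ℕ) + 1 < j → s i ∩ s j = ∅) :
    Pairwise fun i j => (s i ∩ s j).Subsingleton := by
  have hlt : ∀ i j, i < j → (s i ∩ s j).Subsingleton := fun i j hij => by
    rcases (Nat.succ_le_of_lt (Fin.lt_def.1 hij)).eq_or_lt with h | h
    · obtain ⟨z, hz⟩ := hadj i j h
      exact hz ▸ subsingleton_singleton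
    · exact hdisj i j h ▸ subsingleton_empty
  intro i j hij
  rcases hij.lt_or_gt with h | h
  · exact hlt i j h
  · exact inter_comm (s i) (s j) ▸ hlt j i h

variable [MetricSpace X] {Λ : Set X}

theorem IsContractiveSimilitude.exists_nndist_map {S : X → X} (h : IsContractiveSimilitude S) :
    ∃ ρ : ℝ≥0, 0 < ρ ∧ ρ < 1 ∧ ∀ x y, nndist (S x) (S y) = ρ * nndist x y := by
  obtain ⟨ρ, h0, h1, hS⟩ := h
  exact ⟨⟨ρ, h0.le⟩, h0, h1, fun x y => NNReal.eq (hS x y)⟩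

theorem IsSelfSimilarArc.isConnected (hΛ : IsSelfSimilarArc Λ) : IsConnected Λ := by
  obtain ⟨⟨γ⟩, -⟩ := hΛ
  exact isConnected_iff_connectedSpace.2 (γ.surjective.connectedSpace γ.continuous)

theorem IsSelfSimilarArc.nontrivial (hΛ : IsSelfSimilarArc Λ) : Nontrivial Λ := by
  obtain ⟨⟨γ⟩, -⟩ := hΛ
  exact γ.symm.surjective.nontrivial

theorem IsSelfSimilarArc.exists_packing (hΛ : IsSelfSimilarArc Λ) :
    ∃ (l : ℕ) (φ : Fin l → Λ → Λ) (ρ : Fin l → ℝ≥0), IsSimilarityPacking φ ρ ∧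
      (∀ i, ρ i < 1) ∧ ∀ y, ∃ i x, φ i x = y := by
  obtain ⟨-, l, S, hS, hadj, hdisj⟩ := hΛ
  choose ρ hρ₀ hρ₁ hdist using fun i => (hS.similitude i).exists_nndist_map
  have hmaps : ∀ i, MapsTo (S i) Λ Λ := fun i x hx =>
    hS.invariant.ge (mem_iUnion.2 ⟨i, mem_image_of_mem _ hx⟩)
  refine ⟨l, fun i => (hmaps i).restrict, ρ,
    ⟨hρ₀, fun i x y => hdist i x y, fun i j hij => ?_⟩, hρ₁, fun y => ?_⟩
  · have hval : ∀ i, range (hmaps i).restrict = Subtype.val ⁻¹' (S i '' Λ) := fun i =>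
      (hmaps i).range_restrict
    simp only [hval, ← preimage_inter]
    exact (pairwise_subsingleton_inter_of_consecutive hadj hdisj hij).preimage
      Subtype.val_injective
  · obtain ⟨i, x, hx, hxy⟩ := mem_iUnion.1 (hS.invariant.le y.2)
    exact ⟨i, ⟨x, hx⟩, Subtype.ext hxy⟩

theorem dimH_univ_subtype (E : Set X) : dimH (univ : Set E) = dimH E := by
  rw [← isometry_subtype_coe.dimH_image, image_univ, Subtype.range_coe]

theorem IsSelfSimilarArc.exists_holderWith_nowhereConstant (hΛ : IsSelfSimilarArc Λ) {r : ℝ≥0}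
    (hr : 0 < r) (hdim : r < dimH Λ) :
    ∃ (C : ℝ≥0) (f : Λ → ℝ), HolderWith C r f ∧ NowhereConstant f := by
  obtain ⟨⟨γ⟩, -⟩ := id hΛ
  have := hΛ.nontrivial
  have := isConnected_iff_connectedSpace.1 hΛ.isConnected
  have := γ.compactSpace
  obtain ⟨l, φ, ρ, hφ, hρ, hcover⟩ := hΛ.exists_packing
  have hsum : 1 < ∑ i, ρ i ^ (r : ℝ) := by
    by_contra! hle
    have hdim_le := dimH_univ_le_of_sum_rpow_le_one hφ.lipschitzWith hρ hcover hle
    exact hdim.not_ge (dimH_univ_subtype Λ ▸ hdim_le)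
  obtain ⟨C, f, hf, hinj⟩ := (hφ.isChainSeparated hρ hcover γ hr hsum).exists_holderWith_injOn_range
    hr (TopologicalSpace.denseSeq Λ)
  exact ⟨C, f, hf, nowhereConstant_of_injOn_dense (TopologicalSpace.denseRange_denseSeq Λ) hinj⟩

end SelfSimilarArc

section Criticality

variable {X : Type*} [MetricSpace X] {E : Set X}

theorem one_le_dimH_of_isPreconnected {s : Set ℝ} (hs : IsPreconnected s) (hnt : s.Nontrivial) :
    1 ≤ dimH s := by
  obtain ⟨x, hx, y, hy, hxy⟩ := hnt.exists_lt
  have hint : (interior s).Nonempty := (nonempty_Ioo.2 hxy).mono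
    (interior_maximal (Ioo_subset_Icc_self.trans (hs.Icc_subset hx hy)) isOpen_Ioo)
  simp [Real.dimH_of_nonempty_interior hint]

theorem holderWith_of_abs_sub_le {f : X → ℝ} {M r : ℝ} (hM : 0 ≤ M) (hr : 0 ≤ r)
    (hf : ∀ x y, |f x - f y| ≤ M * dist x y ^ r) :
    HolderWith M.toNNReal r.toNNReal f := fun x y => by
  rw [edist_dist, edist_dist, Real.coe_toNNReal r hr, ENNReal.ofReal_rpow_of_nonneg dist_nonneg hr,
    ENNReal.ofNNReal_toNNReal, ← ENNReal.ofReal_mul hM]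
  exact ENNReal.ofReal_le_ofReal (hf x y)

theorem mem_holderExponents_of_holderWith {C r : ℝ≥0} {f : E → ℝ} (hf : HolderWith C r f)
    (hne : ∃ x y, f x ≠ f y) : (r : ℝ) ∈ holderExponents E := by
  refine ⟨f, hne, C + 1, by positivity, fun x y => (hf.dist_le x y).trans ?_⟩
  gcongr
  simp

theorem one_mem_holderExponents [Nontrivial E] : (1 : ℝ) ∈ holderExponents E := by
  obtain ⟨x, y, hxy⟩ := exists_pair_ne E
  exact mem_holderExponents_of_holderWith (LipschitzWith.dist_left x).holderWith
    ⟨x, y, by simpa using hxy.symm⟩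

theorem ofReal_le_dimH_of_mem_holderExponents (hE : IsPreconnected E) {r : ℝ}
    (hr : r ∈ holderExponents E) : ENNReal.ofReal r ≤ dimH E := by
  obtain ⟨f, ⟨x, y, hxy⟩, M, hM, hf⟩ := hr
  rcases le_or_gt r 0 with hr₀ | hr₀
  · simp [ENNReal.ofReal_of_nonpos hr₀]
  have hr₀' : 0 < r.toNNReal := Real.toNNReal_pos.2 hr₀
  have hH := holderWith_of_abs_sub_le hM.le hr₀.le hf
  have := isPreconnected_iff_preconnectedSpace.1 hE
  have hdim := (one_le_dimH_of_isPreconnected (isPreconnected_range (hH.continuous hr₀'))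
    ⟨f x, mem_range_self x, f y, mem_range_self y, hxy⟩).trans (hH.dimH_range_le hr₀')
  rwa [dimH_univ_subtype, ENNReal.le_div_iff_mul_le (.inl (by simpa using hr₀))
    (.inl ENNReal.coe_ne_top), one_mul] at hdim

theorem criticality_le_dimH (hE : IsPreconnected E) : criticality E ≤ dimH E := by
  refine sSup_le ?_
  rintro _ ⟨r, hr, rfl⟩
  refine (EReal.coe_le_coe_iff.2 (le_max_left r 0)).trans ?_
  rw [← EReal.coe_ennreal_ofReal, EReal.coe_ennreal_le_coe_ennreal_iff]
  exact ofReal_le_dimH_of_mem_holderExponents hE hr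

theorem IsSelfSimilarArc.criticality_eq_dimH (hΛ : IsSelfSimilarArc E) :
    criticality E = dimH E := by
  have := hΛ.nontrivial
  refine (criticality_le_dimH hΛ.isConnected.isPreconnected).antisymm
    (le_of_forall_lt fun c hc => ?_)
  obtain ⟨r, hcr, hr⟩ := EReal.lt_iff_exists_real_btwn.1 hc
  rcases le_total r 1 with hr₁ | hr₁
  · exact hcr.trans_le ((EReal.coe_le_coe_iff.2 hr₁).trans
      (le_sSup (mem_image_of_mem _ one_mem_holderExponents)))
  · lift r to ℝ≥0 using zero_le_one.trans hr₁
    obtain ⟨C, f, hf, hnc⟩ := hΛ.exists_holderWith_nowhereConstant (r := r)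
      (one_pos.trans_le (NNReal.coe_le_coe.1 hr₁)) (EReal.coe_ennreal_lt_coe_ennreal_iff.1 hr)
    exact hcr.trans_le (le_sSup (mem_image_of_mem _
      (mem_holderExponents_of_holderWith hf hnc.exists_ne)))

end Criticality

theorem isStrictWhitneySet_of_fderiv_eq_zero {N : ℕ} {A : Set (EuclideanSpace ℝ (Fin N))}
    (hA : IsConnected A) {f : EuclideanSpace ℝ (Fin N) → ℝ} (hf : ContDiff ℝ 1 f)
    (hfA : ∀ x ∈ A, fderiv ℝ f x = 0) (hnc : NowhereConstant (A.domRestrict f)) :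
    IsStrictWhitneySet A := by
  have := hA.nonempty.to_subtype
  refine ⟨hA, f, ⟨hf, fun x hx => by rw [gradient, hfA x hx, map_zero], ?_⟩, ?_⟩
  · obtain ⟨x, y, hxy⟩ := hnc.exists_ne
    exact ⟨x, x.2, y, y.2, hxy⟩
  · rintro U hU ⟨z, hzU, hzA⟩
    obtain ⟨_, ⟨x, hx, rfl⟩, _, ⟨y, hy, rfl⟩, hxy⟩ :=
      hnc _ (hU.preimage continuous_subtype_val) ⟨⟨z, hzA⟩, hzU⟩
    exact ⟨x, ⟨hx, x.2⟩, y, ⟨hy, y.2⟩, hxy⟩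

theorem theorem1_general {E : Type*} [NormedAddCommGroup E] [NormedSpace ℝ E]
    [FiniteDimensional ℝ E] {Λ : Set E} (hΛ : IsSelfSimilarArc Λ) :
    IsConnected Λ ∧ criticality Λ = dimH Λ ∧
      (1 < dimH Λ → ∃ f : E → ℝ, ContDiff ℝ 1 f ∧ (∀ x ∈ Λ, fderiv ℝ f x = 0) ∧
        NowhereConstant (Λ.domRestrict f)) := by
  refine ⟨hΛ.isConnected, hΛ.criticality_eq_dimH, fun hdim => ?_⟩
  obtain ⟨r, hr, hrΛ⟩ := ENNReal.lt_iff_exists_nnreal_btwn.1 hdim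
  have hr₁ : 1 < r := ENNReal.coe_lt_coe.1 hr
  obtain ⟨C, g, hg, hnc⟩ := hΛ.exists_holderWith_nowhereConstant (one_pos.trans hr₁) hrΛ
  obtain ⟨f, hf, hfg⟩ := exists_contDiff_extension_of_holderWith hg hr₁
  have hrestrict : Λ.domRestrict f = g := funext fun x => (hfg x).1
  exact ⟨f, hf, fun x hx => (hfg ⟨x, hx⟩).2, hrestrict ▸ hnc⟩

theorem theorem1 (N : ℕ) (Λ : Set (EuclideanSpace ℝ (Fin N))) (hΛ : IsSelfSimilarArc Λ)
    (s : ℝ) (hs : 1 < s) (hdim : dimH Λ = ENNReal.ofReal s) :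
    IsStrictWhitneySet Λ ∧ criticality Λ = (s : EReal) := by
  obtain ⟨hconn, hcrit, hwhitney⟩ := theorem1_general hΛ
  obtain ⟨f, hf, hfΛ, hnc⟩ := hwhitney (by simpa [hdim] using hs)
  refine ⟨isStrictWhitneySet_of_fderiv_eq_zero hconn hf hfΛ hnc, ?_⟩
  rw [hcrit, hdim, EReal.coe_ennreal_ofReal, max_eq_left (zero_le_one.trans hs.le)]
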